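/- Let $f:\mathbb{C}\to\widehat{\mathbb{C}}$ be a transcendental meromorphic function (with its only essential singularity at $\infty$) that has either at least two poles, or a pole that is not an omitted value of $f$. Suppose that $f$ has a stable Baker omitted value, that is, a point $b\in\mathbb{C}$ such that $f(z)\neq b$ for all $z\in\mathbb{C}$, such that for some open disk $B$ centered at $b$ every connected component of the boundary (in $\mathbb{C}$) of $f^{-1}(B)$ is bounded, and such that all iterates $f^n$, $n\ge 0$, are defined in a neighborhood of $b$. The Fatou set of $f$ is the set of points of $\mathbb{C}$ having a neighborhood on which all iterates $f^n$ are defined and form a normal family. Let $D$ be an invariant rotation domain of $f$, that is, a connected component of the Fatou set with $f(D)\subseteq D$ for which there are an irrational number $\theta$ and a conformal map $\varphi$ of $D$ onto the unit disk $\{|z|<1\}$ (Siegel disk) or onto an annulus $\{1<|z|<r\}$ with $1<r<\infty$ (Herman ring) such that $\varphi\circ f\circ\varphi^{-1}(z)=e^{2\pi i\theta}z$. If $f$ is univalent (injective) on an open set containing the closure $\overline{D}$ of $D$ in $\mathbb{C}$, then the boundary $\partial D$ of $D$ in $\mathbb{C}$ contains no repelling fixed point of $f$, that is, no $z_0$ with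 $f(z_0)=z_0$ and $|f'(z_0)|>1$. -/

import Mathlib

open Set Filter Topology

namespace StableBov

noncomputable section

/-! The Riemann sphere is `OnePoint ℂ`, and `OnePoint.infty` is its point at infinity. -/

/-- The chordal distance on the Riemann sphere. -/
def chordal (a b : OnePoint ℂ) : ℝ :=
  a.elim
    (b.elim 0 fun w : ℂ => 2 / Real.sqrt (1 + ‖w‖ ^ 2))
    (fun z : ℂ => b.elim (2 / Real.sqrt (1 + ‖z‖ ^ 2)) fun w : ℂ =>
      2 * ‖z - w‖ / (Real.sqrt (1 + ‖z‖ ^ 2) * Real.sqrt (1 + ‖w‖ ^ 2)))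

/-- Holomorphic maps from the plane to the Riemann sphere: near each point, `f` or `1 / f` is an
analytic function with values in `ℂ`. The constant map `∞` is included. -/
def IsSphereHolomorphic (f : ℂ → OnePoint ℂ) : Prop :=
  ∀ z : ℂ,
    (∃ g : ℂ → ℂ, AnalyticAt ℂ g z ∧ ∀ᶠ w in 𝓝 z, f w = (g w : OnePoint ℂ)) ∨
    (∃ g : ℂ → ℂ, AnalyticAt ℂ g z ∧ g z = 0 ∧
      ∀ᶠ w in 𝓝 z, (g w = 0 ∧ f w = OnePoint.infty) ∨
        (g w ≠ 0 ∧ f w = ((g w)⁻¹ : ℂ)))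

/-- Transcendental meromorphic functions on the plane: `∞` is an essential singularity, which for
a map that is meromorphic on `ℂ` means that `f` has no limit in the sphere at `∞`. -/
def IsTranscendentalMeromorphic (f : ℂ → OnePoint ℂ) : Prop :=
  IsSphereHolomorphic f ∧ ¬ ∃ a : OnePoint ℂ, Tendsto f (cocompact ℂ) (𝓝 a)

/-- General transcendental meromorphic functions: at least two poles, or a pole that is not an
omitted value. -/
def IsGeneralTranscendental (f : ℂ → OnePoint ℂ) : Prop :=
  IsTranscendentalMeromorphic f ∧
    ((∃ p q : ℂ, p ≠ q ∧ f p = OnePoint.infty ∧ f q = OnePoint.infty) ∨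
      (∃ p : ℂ, f p = OnePoint.infty ∧ ∃ z : ℂ, f z = (p : OnePoint ℂ)))

/-- `f` as a self-map of the sphere. The value at `∞`, where `f` is not defined, is arbitrary; it
is never used at a point where `IterDefinedAt` holds. -/
def extend (f : ℂ → OnePoint ℂ) : OnePoint ℂ → OnePoint ℂ :=
  fun a => a.elim OnePoint.infty f

/-- The `n`-th iterate of `f`. -/
def iter (f : ℂ → OnePoint ℂ) (n : ℕ) (z : ℂ) : OnePoint ℂ :=
  (extend f)^[n] (z : OnePoint ℂ)

/-- The `n`-th iterate is defined at `z`: none of the earlier points of the orbit is `∞`. -/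
def IterDefinedAt (f : ℂ → OnePoint ℂ) (n : ℕ) (z : ℂ) : Prop :=
  ∀ k < n, iter f k z ≠ OnePoint.infty

/-- Locally uniform convergence on `U` with respect to the chordal metric. -/
def ConvergesLocUnif (F : ℕ → ℂ → OnePoint ℂ) (G : ℂ → OnePoint ℂ) (U : Set ℂ) : Prop :=
  ∀ z ∈ U, ∃ W ∈ 𝓝[U] z, ∀ ε : ℝ, 0 < ε → ∀ᶠ n in atTop, ∀ w ∈ W, chordal (F n w) (G w) < ε

/-- Normality in the sense of Montel: every sequence of members of the family has a subsequence
that converges locally uniformly on `U`. -/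
def IsNormalOn (F : ℕ → ℂ → OnePoint ℂ) (U : Set ℂ) : Prop :=
  ∀ s : ℕ → ℕ, ∃ t : ℕ → ℕ, StrictMono t ∧
    ∃ G : ℂ → OnePoint ℂ, ConvergesLocUnif (fun n => F (s (t n))) G U

/-- The Fatou set (`∞` always belongs to the Julia set, so this is a subset of the plane). -/
def fatouSet (f : ℂ → OnePoint ℂ) : Set ℂ :=
  {z | ∃ U : Set ℂ, IsOpen U ∧ z ∈ U ∧ (∀ w ∈ U, ∀ n, IterDefinedAt f n w) ∧
    IsNormalOn (iter f) U}

/-- Fatou components: the connected components of the Fatou set. -/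
def IsFatouComponent (f : ℂ → OnePoint ℂ) (V : Set ℂ) : Prop :=
  ∃ z ∈ fatouSet f, V = connectedComponentIn (fatouSet f) z

/-- `b` is an omitted value of `f`. -/
def IsOmittedValue (f : ℂ → OnePoint ℂ) (b : ℂ) : Prop :=
  ∀ z : ℂ, f z ≠ (b : OnePoint ℂ)

/-- The preimage in the plane of the disk with centre `b` and radius `r`. -/
def diskPreimage (f : ℂ → OnePoint ℂ) (b : ℂ) (r : ℝ) : Set ℂ :=
  {z | ∃ w ∈ Metric.ball b r, f z = (w : OnePoint ℂ)}

/-- Baker omitted values. -/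
def IsBakerOmittedValue (f : ℂ → OnePoint ℂ) (b : ℂ) : Prop :=
  IsOmittedValue f b ∧ ∃ r : ℝ, 0 < r ∧
    ∀ z ∈ frontier (diskPreimage f b r),
      Bornology.IsBounded (connectedComponentIn (frontier (diskPreimage f b r)) z)

/-- The class of general transcendental meromorphic functions with a stable Baker omitted value:
all iterates are defined in a neighbourhood of it. -/
def HasStableBov (f : ℂ → OnePoint ℂ) : Prop :=
  IsGeneralTranscendental f ∧ ∃ b : ℂ, IsBakerOmittedValue f b ∧
    ∃ U ∈ 𝓝 b, ∀ w ∈ U, ∀ n, IterDefinedAt f n w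

/-- `p`-periodic Fatou components. -/
def IsPeriodicComponent (f : ℂ → OnePoint ℂ) (p : ℕ) (V : Set ℂ) : Prop :=
  IsFatouComponent f V ∧ 1 ≤ p ∧ ∀ z ∈ V, ∃ w ∈ V, iter f p z = (w : OnePoint ℂ)

/-- A conformal map of `V` onto `A` conjugates `f^p` on `V` to an irrational rotation. -/
def ConjugateToRotation (f : ℂ → OnePoint ℂ) (p : ℕ) (V A : Set ℂ) : Prop :=
  ∃ φ : ℂ → ℂ, DifferentiableOn ℂ φ V ∧ BijOn φ V A ∧
    ∃ θ : ℝ, Irrational θ ∧ ∀ z ∈ V, ∀ w ∈ V, iter f p z = (w : OnePoint ℂ) →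
      φ w = Complex.exp (2 * Real.pi * Complex.I * θ) * φ z

/-- `p`-periodic Siegel disks. -/
def IsSiegelDisk (f : ℂ → OnePoint ℂ) (p : ℕ) (V : Set ℂ) : Prop :=
  IsPeriodicComponent f p V ∧ ConjugateToRotation f p V {z | ‖z‖ < 1}

/-- `p`-periodic Herman rings. -/
def IsHermanRing (f : ℂ → OnePoint ℂ) (p : ℕ) (V : Set ℂ) : Prop :=
  IsPeriodicComponent f p V ∧
    ∃ r : ℝ, 1 < r ∧ ConjugateToRotation f p V {z | 1 < ‖z‖ ∧ ‖z‖ < r}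

/-- `p`-periodic rotation domains; the invariant ones are those with `p = 1`. -/
def IsRotationDomain (f : ℂ → OnePoint ℂ) (p : ℕ) (V : Set ℂ) : Prop :=
  IsSiegelDisk f p V ∨ IsHermanRing f p V

/-- The complex-valued function that agrees with `f` away from the poles of `f`. -/
def finitePart (f : ℂ → OnePoint ℂ) (z : ℂ) : ℂ :=
  (f z).elim 0 id

/-- Repelling fixed points. -/
def IsRepellingFixedPoint (f : ℂ → OnePoint ℂ) (z₀ : ℂ) : Prop :=
  f z₀ = (z₀ : OnePoint ℂ) ∧ 1 < ‖deriv (finitePart f) z₀‖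

end

end StableBov

/-!
Near a repelling fixed point `z₀` the map `f` has a local inverse that fixes `z₀` and contracts
towards it (`exists_contracting_right_inverse`). On the rotation domain `D`, which is open, `f` is
bijective and its inverse is again conjugate to a rotation (`IsRotationDomain.exists_conformal`).
If `z₀` lies on the boundary of `D`, then `z₀ ∈ closure D ⊆ N`, and injectivity of `f` on `N` forces
the two inverses to agree at the points of `D` close to `z₀`. Hence the backward orbit in `D` of such
a point converges to `z₀ ∉ D`. But backward orbits of a rotation are recurrent
(`frequently_mem_of_conj_rotation`), so they return to a neighbourhood of the starting point
infinitely often, away from `z₀`, which is a contradiction.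
-/

open Set Filter Topology

namespace StableBov

/-! ### Rotation domains -/

theorem isOpen_fatouSet (f : ℂ → OnePoint ℂ) : IsOpen (fatouSet f) := by
  refine isOpen_iff_mem_nhds.2 ?_
  rintro z ⟨U, hU, hzU, hdef, hnormal⟩
  exact mem_of_superset (hU.mem_nhds hzU) fun w hw => ⟨U, hU, hw, hdef, hnormal⟩

theorem IsFatouComponent.isOpen {f : ℂ → OnePoint ℂ} {V : Set ℂ} (hV : IsFatouComponent f V) :
    IsOpen V := by
  obtain ⟨z, -, rfl⟩ := hV
  exact (isOpen_fatouSet f).connectedComponentIn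

theorem IsRotationDomain.isFatouComponent {f : ℂ → OnePoint ℂ} {p : ℕ} {V : Set ℂ}
    (hV : IsRotationDomain f p V) : IsFatouComponent f V :=
  hV.elim (fun h => h.1.1) fun h => h.1.1

/-- If `φ` conjugates `f ^ p` on `V` to a rotation of a rotation-invariant set `A`, then `f ^ p`
maps `V` onto itself, and `φ` conjugates preimages to the inverse rotation. -/
theorem ConjugateToRotation.exists_preimage {f : ℂ → OnePoint ℂ} {p : ℕ} {V A : Set ℂ}
    (hV : IsPeriodicComponent f p V) (hA : ∀ ζ : Circle, ∀ u ∈ A, (ζ : ℂ) * u ∈ A)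
    (h : ConjugateToRotation f p V A) :
    ∃ φ : ℂ → ℂ, DifferentiableOn ℂ φ V ∧ InjOn φ V ∧ ∃ ζ : Circle, ∀ w ∈ V, ∃ w' ∈ V,
      iter f p w' = (w : OnePoint ℂ) ∧ φ w' = ζ * φ w := by
  obtain ⟨φ, hφ, hbij, θ, -, hrot⟩ := h
  refine ⟨φ, hφ, hbij.injOn, (Circle.exp (2 * Real.pi * θ))⁻¹, fun w hw => ?_⟩
  have hexp : Complex.exp (2 * Real.pi * Complex.I * θ) = Circle.exp (2 * Real.pi * θ) := by
    rw [Circle.coe_exp]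
    push_cast
    ring_nf
  obtain ⟨w', hw', hφw'⟩ := hbij.surjOn (hA (Circle.exp (2 * Real.pi * θ))⁻¹ _ (hbij.mapsTo hw))
  obtain ⟨v, hv, hfv⟩ := hV.2.2 w' hw'
  have hvw : v = w := by
    refine hbij.injOn hv hw ?_
    rw [hrot w' hw' v hv hfv, hφw', hexp, ← mul_assoc, ← Circle.coe_mul, mul_inv_cancel,
      Circle.coe_one, one_mul]
  exact ⟨w', hw', hvw ▸ hfv, hφw'⟩

/-- The common part of the definitions of Siegel disks and Herman rings that matters for backward
orbits. -/
theorem IsRotationDomain.exists_conformal {f : ℂ → OnePoint ℂ} {p : ℕ} {V : Set ℂ}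
    (hV : IsRotationDomain f p V) :
    ∃ φ : ℂ → ℂ, DifferentiableOn ℂ φ V ∧ InjOn φ V ∧ ∃ ζ : Circle, ∀ w ∈ V, ∃ w' ∈ V,
      iter f p w' = (w : OnePoint ℂ) ∧ φ w' = ζ * φ w := by
  rcases hV with ⟨hV, h⟩ | ⟨hV, r, -, h⟩
  · exact h.exists_preimage hV fun ζ u hu => by
      simpa only [mem_ofPred_eq, norm_mul, Circle.norm_coe ζ, one_mul] using hu
  · exact h.exists_preimage hV fun ζ u hu => by
      simpa only [mem_ofPred_eq, norm_mul, Circle.norm_coe ζ, one_mul] using hu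

/-! ### Recurrence -/

/-- An orbit that an injective holomorphic map conjugates to an orbit of a rotation is recurrent. -/
theorem frequently_mem_of_conj_rotation {V : Set ℂ} (hV : IsOpen V) {φ : ℂ → ℂ}
    (hφ : DifferentiableOn ℂ φ V) (hinj : InjOn φ V) (ζ : Circle) {w : ℕ → ℂ}
    (hw : ∀ n, w n ∈ V) (hrot : ∀ n, φ (w (n + 1)) = ζ * φ (w n)) {S : Set ℂ}
    (hS : S ∈ 𝓝 (w 0)) : ∃ᶠ n in atTop, w n ∈ S := by
  have hVw : V ∈ 𝓝 (w 0) := hV.mem_nhds (hw 0)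
  have hopen : 𝓝 (φ (w 0)) ≤ map φ (𝓝 (w 0)) := by
    refine ((hφ.analyticAt hVw).eventually_constant_or_nhds_le_map_nhds).resolve_left fun hc => ?_
    have hsub : ∀ᶠ z in 𝓝 (w 0), z = w 0 := by
      filter_upwards [hc, hVw] with z hz hzV using hinj hzV (hw 0) hz
    obtain ⟨z, hz, hne⟩ := ((hsub.filter_mono nhdsWithin_le_nhds).and
      (self_mem_nhdsWithin : {w 0}ᶜ ∈ 𝓝[≠] (w 0))).exists
    exact hne hz
  have hpow : ∀ n, φ (w n) = (ζ ^ n : Circle) * φ (w 0) := by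
    intro n
    induction n with
    | zero => simp
    | succ n ih => rw [hrot, ih, pow_succ', Circle.coe_mul, mul_assoc]
  have himage : φ '' (S ∩ V) ∈ 𝓝 (φ (w 0)) := hopen (image_mem_map (inter_mem hS hVw))
  have hcont : Tendsto (fun η : Circle => (η : ℂ) * φ (w 0)) (𝓝 1) (𝓝 (φ (w 0))) := by
    have : Continuous fun η : Circle => (η : ℂ) * φ (w 0) := by fun_prop
    simpa using this.tendsto 1
  refine ((mapClusterPt_one_atTop_pow ζ).frequently (hcont himage)).mono ?_
  rintro n ⟨z, ⟨hzS, hzV⟩, hz⟩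
  exact hinj hzV (hw n) (hz.trans (hpow n).symm) ▸ hzS

/-! ### Repelling fixed points -/

/-- A sphere-holomorphic map is, near a point that is not a pole, given by its finite part, which is
analytic there. -/
theorem IsSphereHolomorphic.analyticAt_finitePart {f : ℂ → OnePoint ℂ}
    (hf : IsSphereHolomorphic f) {z : ℂ} (hz : f z ≠ OnePoint.infty) :
    AnalyticAt ℂ (finitePart f) z ∧ ∀ᶠ w in 𝓝 z, f w = (finitePart f w : OnePoint ℂ) := by
  rcases hf z with ⟨g, hg, hfg⟩ | ⟨g, -, hg0, hfg⟩
  · have hfin : ∀ᶠ w in 𝓝 z, g w = finitePart f w := by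
      filter_upwards [hfg] with w hw
      rw [finitePart, hw]
      rfl
    refine ⟨hg.congr hfin, ?_⟩
    filter_upwards [hfg, hfin] with w hw hw'
    rw [hw, hw']
  · rcases hfg.self_of_nhds with h | h
    · exact absurd h.2 hz
    · exact absurd hg0 h.1

/-- Near a repelling fixed point there is a local right inverse that contracts towards the point. -/
theorem exists_contracting_right_inverse {g : ℂ → ℂ} {z₀ : ℂ} (hg : AnalyticAt ℂ g z₀)
    (hfix : g z₀ = z₀) (hrep : 1 < ‖deriv g z₀‖) :
    ∃ l : ℂ → ℂ, ∃ c < 1, 0 ≤ c ∧ ∀ᶠ w in 𝓝 z₀, g (l w) = w ∧ ‖l w - z₀‖ ≤ c * ‖w - z₀‖ := by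
  have hne : deriv g z₀ ≠ 0 := norm_pos_iff.1 (one_pos.trans hrep)
  have hstrict := hg.hasStrictDerivAt
  have hlz : hstrict.localInverse g _ z₀ hne z₀ = z₀ := by
    simpa only [hfix] using (hstrict.hasStrictFDerivAt_equiv hne).localInverse_apply_image
  have hright : ∀ᶠ w in 𝓝 z₀, g (hstrict.localInverse g _ z₀ hne w) = w := by
    simpa only [hfix] using (hstrict.hasStrictFDerivAt_equiv hne).eventually_right_inverse
  have hderiv : HasDerivAt (hstrict.localInverse g _ z₀ hne) (deriv g z₀)⁻¹ z₀ := by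
    simpa only [hfix] using (hstrict.to_localInverse hne).hasDerivAt
  obtain ⟨c, hc, hc1⟩ := exists_between (inv_lt_one_of_one_lt₀ hrep)
  have hc0 : 0 ≤ c := (inv_nonneg.2 (norm_nonneg _)).trans hc.le
  refine ⟨hstrict.localInverse g _ z₀ hne, c, hc1, hc0, hright.and ?_⟩
  have := hderiv.isLittleO.def (sub_pos.2 hc)
  filter_upwards [this] with w hw
  rw [hlz] at hw
  calc ‖hstrict.localInverse g _ z₀ hne w - z₀‖
      = ‖(hstrict.localInverse g _ z₀ hne w - z₀ - (w - z₀) • (deriv g z₀)⁻¹)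
          + (w - z₀) • (deriv g z₀)⁻¹‖ := by rw [sub_add_cancel]
    _ ≤ (c - ‖deriv g z₀‖⁻¹) * ‖w - z₀‖ + ‖w - z₀‖ * ‖deriv g z₀‖⁻¹ := by
        refine (norm_add_le _ _).trans (add_le_add hw ?_)
        rw [norm_smul, norm_inv]
    _ = c * ‖w - z₀‖ := by ring

/-- If `f` is injective near the closure of `D` and maps `D` onto itself, then points of `D` close to
a repelling fixed point `z₀` in the closure of `D` have their preimages in `D` closer to `z₀`. -/
theorem exists_preimage_contraction {f : ℂ → OnePoint ℂ} (hf : IsSphereHolomorphic f)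
    {D N : Set ℂ} (hN : IsOpen N) (hDN : closure D ⊆ N) (hinj : InjOn f N) {z₀ : ℂ}
    (hz₀ : z₀ ∈ closure D) (hrep : IsRepellingFixedPoint f z₀) :
    ∃ c < 1, 0 ≤ c ∧ ∃ δ > 0, ∀ w ∈ Metric.ball z₀ δ, ∀ w' ∈ D, f w' = (w : OnePoint ℂ) →
      dist w' z₀ ≤ c * dist w z₀ := by
  obtain ⟨hfix, hderiv⟩ := hrep
  obtain ⟨han, hfin⟩ := hf.analyticAt_finitePart (hfix ▸ OnePoint.coe_ne_infty z₀)
  have hgfix : finitePart f z₀ = z₀ := by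
    rw [finitePart, hfix]
    rfl
  obtain ⟨l, c, hc1, hc0, hl⟩ := exists_contracting_right_inverse han hgfix hderiv
  have hlz : l z₀ = z₀ := by
    simpa [sub_eq_zero] using hl.self_of_nhds.2
  have hlim : Tendsto l (𝓝 z₀) (𝓝 z₀) := by
    rw [tendsto_iff_norm_sub_tendsto_zero]
    refine squeeze_zero' (Eventually.of_forall fun _ => norm_nonneg _) (hl.mono fun w hw => hw.2) ?_
    have : Continuous fun w => c * ‖w - z₀‖ := by fun_prop
    simpa using this.tendsto z₀
  have hev : ∀ᶠ w in 𝓝 z₀, l w ∈ N ∧ f (l w) = (w : OnePoint ℂ) ∧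
      dist (l w) z₀ ≤ c * dist w z₀ := by
    filter_upwards [hl, hlim (hN.mem_nhds (hDN hz₀)), hlim.eventually hfin] with w hw hwN hwf
    refine ⟨hwN, ?_, by simpa only [dist_eq_norm] using hw.2⟩
    rw [hwf, hw.1]
  obtain ⟨δ, hδ, hball⟩ := Metric.eventually_nhds_iff_ball.1 hev
  refine ⟨c, hc1, hc0, δ, hδ, fun w hw w' hw' hfw' => ?_⟩
  obtain ⟨hlN, hfl, hdist⟩ := hball w hw
  -- Both `w'` and the local inverse at `w` lie in `N` and are mapped to `w`.
  rwa [hinj (hDN (subset_closure hw')) hlN (hfw'.trans hfl.symm)]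

end StableBov

theorem mainTheorem9 (f : ℂ → OnePoint ℂ) (hf : StableBov.HasStableBov f)
    (D : Set ℂ) (hD : StableBov.IsRotationDomain f 1 D)
    (N : Set ℂ) (hN : IsOpen N) (hDN : closure D ⊆ N) (hinj : Set.InjOn f N) :
    ¬ ∃ z₀ ∈ frontier D, StableBov.IsRepellingFixedPoint f z₀ := by
  rintro ⟨z₀, hz₀, hrep⟩
  have hDo : IsOpen D := hD.isFatouComponent.isOpen
  rw [hDo.frontier_eq] at hz₀
  obtain ⟨c, hc1, hc0, δ, hδ, hcontr⟩ :=
    StableBov.exists_preimage_contraction hf.1.1.1 hN hDN hinj hz₀.1 hrep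
  obtain ⟨φ, hφ, hφinj, ζ, hpre⟩ := hD.exists_conformal
  choose! b hbD hfb hφb using hpre
  obtain ⟨w, hwD, hw⟩ := Metric.mem_closure_iff.1 hz₀.1 δ hδ
  have horb : ∀ n, b^[n] w ∈ D := by
    intro n
    induction n with
    | zero => exact hwD
    | succ n ih =>
      rw [Function.iterate_succ_apply']
      exact hbD _ ih
  -- The backward orbit of `w` in `D` converges to `z₀`.
  have hdist : ∀ n, dist (b^[n] w) z₀ ≤ c ^ n * dist w z₀ := by
    intro n
    induction n with
    | zero => simp
    | succ n ih =>
      have hball : b^[n] w ∈ Metric.ball z₀ δ := by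
        refine (ih.trans ?_).trans_lt (dist_comm z₀ w ▸ hw)
        exact mul_le_of_le_one_left dist_nonneg (pow_le_one₀ hc0 hc1.le)
      rw [Function.iterate_succ_apply', pow_succ', mul_assoc]
      exact (hcontr _ hball _ (hbD _ (horb n)) (hfb _ (horb n))).trans
        (mul_le_mul_of_nonneg_left ih hc0)
  have hlim : Tendsto (fun n => b^[n] w) atTop (𝓝 z₀) := by
    rw [tendsto_iff_dist_tendsto_zero]
    refine squeeze_zero (fun _ => dist_nonneg) hdist ?_
    simpa using (tendsto_pow_atTop_nhds_zero_of_lt_one hc0 hc1).mul_const (dist w z₀)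
  have hne : w ≠ z₀ := fun h => hz₀.2 (h ▸ hwD)
  obtain ⟨S, T, hS, hT, hST⟩ := t2_separation_nhds hne
  -- Recurrence brings the orbit back to the neighbourhood `S` of `w`, away from `z₀`.
  have hfreq := StableBov.frequently_mem_of_conj_rotation hDo hφ hφinj ζ (w := fun n => b^[n] w)
    horb (fun n => by
      rw [Function.iterate_succ_apply']
      exact hφb _ (horb n)) hS
  obtain ⟨n, hnS, hnT⟩ := (hfreq.and_eventually (hlim hT)).exists
  exact disjoint_left.1 hST hnS hnT
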